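/- All groups are finite. A subgroup $H$ of a group $G$ is $\mathbb{P}$-subnormal in $G$ if $H=G$ or there is a chain of subgroups $H=H_0\leqslant H_1\leqslant\cdots\leqslant H_n=G$ such that $|H_i:H_{i-1}|$ is a prime for every $i=1,\dots,n$. A group is w-supersoluble if each of its Sylow subgroups is $\mathbb{P}$-subnormal in it. A group $G=AB$, where $A$ and $B$ are subgroups of $G$, is a weak normal product of $A$ and $B$ if $A$ is normal in $G$ and $B$ permutes with every maximal subgroup $M$ of every Sylow subgroup of $A$ (that is, $BM=MB$). Corollary B. Let the finite group $G=AB$ be a weak normal product of w-supersoluble subgroups $A$ and $B$, with $A$ normal in $G$. If the derived subgroup $G'$ is nilpotent, then $G$ is w-supersoluble. -/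

import Mathlib

open scoped Pointwise

/-- A subgroup `H` of `G` is `ℙ`-subnormal in `G`: there is a chain
`H = C 0 ≤ C 1 ≤ ⋯ ≤ C n = G` all of whose successive indices are prime.
The case `n = 0` is `H = G`. -/
def Subgroup.IsPSubnormal {G : Type*} [Group G] (H : Subgroup G) : Prop :=
  ∃ (n : ℕ) (C : ℕ → Subgroup G), C 0 = H ∧ C n = ⊤ ∧
    ∀ i < n, C i ≤ C (i + 1) ∧ ((C i).relIndex (C (i + 1))).Prime

/-- A group is widely supersoluble (w-supersoluble) if every Sylow subgroup is
`ℙ`-subnormal. Primes not dividing the order make no difference: a Sylow `q`-subgroup of a finite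
group has a chain with prime indices down to the trivial subgroup. -/
def IsWSupersoluble (G : Type*) [Group G] : Prop :=
  ∀ (p : ℕ) [Fact p.Prime] (P : Sylow p G), (P : Subgroup G).IsPSubnormal

/-- Two subgroups permute if `HK = KH` as sets. -/
def Subgroup.Permutes {G : Type*} [Group G] (H K : Subgroup G) : Prop :=
  (H : Set G) * (K : Set G) = (K : Set G) * (H : Set G)

/-- `G = AB` is a weak normal product of `A` and `B`: the subgroup `A` is normal in `G`, and `B`
permutes with every maximal subgroup `M` of every Sylow subgroup `P` of `A`.
(`M ⋖ P` says that `M` is a proper subgroup of `P` with no subgroup strictly in between.) -/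
structure IsWeakNormalProduct {G : Type*} [Group G] (A B : Subgroup G) : Prop where
  mul_eq : (A : Set G) * (B : Set G) = Set.univ
  normal : A.Normal
  permutes : ∀ (p : ℕ) [Fact p.Prime] (P : Sylow p A) (M : Subgroup A),
    M ⋖ (P : Subgroup A) → B.Permutes (M.map A.subtype)

open scoped Pointwise commutatorElement

/-! Induct on |G| and take a minimal normal subgroup V ≤ A (if A = 1, then G = B). Nilpotency of G'
makes V an elementary abelian q-group centralized by G'. By induction PV is ℙ-subnormal for each
Sylow p-subgroup P, so only p ≠ q matters, and it suffices that P normalizes every cyclic subgroup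
of V: then P climbs to PV by steps of index q.

As G' centralizes V, each eigenspace {x ∈ V | gxg⁻¹ = xⁿ} is normal in G. Hence one nontrivial
eigenvector makes g act on all of V as a power map (`IsMinimalNormal.mem_powerNormalizer`), and the
task is to find eigenvectors.

If a normal W ≠ 1 does not contain V, then PW is ℙ-subnormal and avoids V; the first member of its
chain that meets V meets it in prime order, which gives an eigenvector.

Otherwise G' is a q-group, and the Sylow q-subgroup Q of A is normal in G. If V lies in every
maximal subgroup of Q, then Q = V C_Q(g^(q-1)) forces g^(q-1) to centralize Q, so g is
diagonalizable on V. If not, Q is elementary abelian, and A and B both act on V by powers: for B,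
either B meets V and w-supersolubility applies, or permutability with a hyperplane of Q does. -/

namespace Subgroup

variable {G G' : Type*} [Group G] [Group G']

/-! ### Chains of prime index -/

/-- `H` is a subgroup of prime index in `K`. -/
def PrimeStep (H K : Subgroup G) : Prop :=
  H ≤ K ∧ (H.relIndex K).Prime

theorem isPSubnormal_iff_reflTransGen {H : Subgroup G} :
    H.IsPSubnormal ↔ Relation.ReflTransGen PrimeStep H ⊤ := by
  constructor
  · rintro ⟨n, C, rfl, hn, hC⟩
    rw [← hn]
    clear hn
    induction n with
    | zero => exact .refl
    | succ n ih => exact (ih fun i hi ↦ hC i (by omega)).tail (hC n (by omega))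
  · intro h
    induction h using Relation.ReflTransGen.head_induction_on with
    | refl => exact ⟨0, fun _ ↦ ⊤, rfl, rfl, by simp⟩
    | @head H K hHK _ ih =>
      obtain ⟨n, C, h0, hn, hC⟩ := ih
      refine ⟨n + 1, fun i ↦ Nat.casesOn i H C, rfl, hn, ?_⟩
      rintro (_ | i) hi
      · change H ≤ C 0 ∧ (H.relIndex (C 0)).Prime
        rwa [h0]
      · exact hC i (by omega)

theorem reflTransGen_primeStep_of_dvd {H K : Subgroup G} {r : ℕ} (hr : r.Prime) (hHK : H ≤ K)
    (h : H.relIndex K ∣ r) : Relation.ReflTransGen PrimeStep H K := by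
  rcases (Nat.dvd_prime hr).1 h with h | h
  · rw [le_antisymm hHK (relIndex_eq_one.1 h)]
  · exact .single ⟨hHK, h ▸ hr⟩

protected theorem IsPSubnormal.map {H : Subgroup G} (hH : H.IsPSubnormal) {f : G →* G'}
    (hf : Function.Surjective f) : (H.map f).IsPSubnormal := by
  rw [isPSubnormal_iff_reflTransGen] at hH ⊢
  rw [← map_top_of_surjective f hf]
  generalize (⊤ : Subgroup G) = T at hH
  induction hH with
  | refl => exact .refl
  | @tail X Y _ hXY ih =>
    refine ih.trans ?_
    refine reflTransGen_primeStep_of_dvd hXY.2 (map_mono hXY.1) ?_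
    rw [← relIndex_comap]
    exact relIndex_dvd_of_le_left Y (le_comap_map f X)

protected theorem IsPSubnormal.comap {H : Subgroup G'} (hH : H.IsPSubnormal) {f : G →* G'}
    (hf : Function.Surjective f) : (H.comap f).IsPSubnormal := by
  rw [isPSubnormal_iff_reflTransGen] at hH ⊢
  rw [← comap_top f]
  refine hH.lift (Subgroup.comap f) fun X Y hXY ↦ ⟨comap_mono hXY.1, ?_⟩
  rw [relIndex_comap, map_comap_eq_self_of_surjective hf]
  exact hXY.2

/-- |N : H ∩ N| = |HN : H|, because HN is a subgroup. -/
theorem relIndex_dvd_index_of_right_normal [Finite G] (H N : Subgroup G) [N.Normal] :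
    H.relIndex N ∣ H.index := by
  have h₁ := relIndex_mul_relIndex (H ⊓ N) N (H ⊔ N) inf_le_right le_sup_right
  have h₂ := relIndex_mul_relIndex (H ⊓ N) H (H ⊔ N) inf_le_left le_sup_left
  have h₀ : N.relIndex H ≠ 0 := index_ne_zero_of_finite
  rw [inf_relIndex_right, relIndex_sup_right] at h₁
  rw [inf_relIndex_left, ← h₁, mul_comm, Nat.mul_left_inj h₀] at h₂
  exact h₂ ▸ relIndex_dvd_index_of_le le_sup_left

theorem relIndex_inf_dvd_relIndex [Finite G] (H N K : Subgroup G) [N.Normal] :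
    H.relIndex (N ⊓ K) ∣ H.relIndex K := by
  rw [← relIndex_subgroupOf (inf_le_right : N ⊓ K ≤ K), inf_subgroupOf_right]
  exact relIndex_dvd_index_of_right_normal _ _

/-- If `H` is `ℙ`-subnormal and avoids the nontrivial
normal subgroup `N`, then `H` normalizes a nontrivial cyclic subgroup of `N`. -/
theorem IsPSubnormal.exists_zpowers_eq [Finite G] {H N : Subgroup G} (hH : H.IsPSubnormal)
    [hN : N.Normal] (hN1 : N ≠ ⊥) (hNH : N ⊓ H = ⊥) :
    ∃ x ∈ N, x ≠ 1 ∧ ∀ g ∈ H, ∃ n : ℤ, g * x * g⁻¹ = x ^ n := by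
  rw [isPSubnormal_iff_reflTransGen] at hH
  induction hH using Relation.ReflTransGen.head_induction_on with
  | refl => simp_all
  | @head H K hHK _ ih =>
    by_cases hNK : N ⊓ K = ⊥
    · obtain ⟨x, hxN, hx1, hx⟩ := ih hNK
      exact ⟨x, hxN, hx1, fun g hg ↦ hx g (hHK.1 hg)⟩
    -- H meets N ∩ K trivially, so the order of N ∩ K is its index over H ∩ N ∩ K, which divides the
    -- prime |K : H|.
    · have hcard : Nat.card (N ⊓ K : Subgroup G) ∣ H.relIndex K := by
        have h : H ⊓ (N ⊓ K) = ⊥ := by rw [inf_comm, inf_assoc, inf_eq_right.2 hHK.1, hNH]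
        rw [← relIndex_bot_left, ← h, inf_relIndex_right]
        exact relIndex_inf_dvd_relIndex H N K
      have hprime : (Nat.card (N ⊓ K : Subgroup G)).Prime := by
        rcases (Nat.dvd_prime hHK.2).1 hcard with h | h
        · exact absurd (card_eq_one.1 h) hNK
        · exact h ▸ hHK.2
      have := Fact.mk hprime
      obtain ⟨x, hx1⟩ := (N ⊓ K).ne_bot_iff_exists_ne_one.1 hNK
      refine ⟨x, x.2.1, by simpa using hx1, fun g hg ↦ ?_⟩
      have hgK := hHK.1 hg
      have hmem : g * x * g⁻¹ ∈ N ⊓ K :=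
        ⟨hN.conj_mem _ x.2.1 g, K.mul_mem (K.mul_mem hgK x.2.2) (K.inv_mem hgK)⟩
      obtain ⟨n, hn⟩ := mem_zpowers_iff.1
        (mem_zpowers_of_prime_card (g' := ⟨_, hmem⟩) rfl hx1)
      exact ⟨n, by simpa using (congrArg Subtype.val hn).symm⟩

end Subgroup

/-! ### Passage to quotients -/

section

open Subgroup

variable {G G' : Type*} [Group G] [Group G']

theorem IsWSupersoluble.of_surjective [Finite G] (hG : IsWSupersoluble G) {f : G →* G'}
    (hf : Function.Surjective f) : IsWSupersoluble G' := by
  intro p _ P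
  obtain ⟨Q, rfl⟩ := Sylow.mapSurjective_surjective hf p P
  exact (hG p Q).map hf

theorem IsWSupersoluble.sup_isPSubnormal [Finite G] {V : Subgroup G} [V.Normal]
    (hV : IsWSupersoluble (G ⧸ V)) {p : ℕ} [Fact p.Prime] (P : Sylow p G) :
    ((P : Subgroup G) ⊔ V).IsPSubnormal := by
  have hf := QuotientGroup.mk'_surjective V
  have h := (hV p (P.mapSurjective hf)).comap hf
  rwa [Sylow.coe_mapSurjective, comap_map_eq, QuotientGroup.ker_mk'] at h

/-- Sylow subgroups of the image lift to A, and the preimage in P of a maximal subgroup of the image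
of P is maximal in P. -/
theorem IsWeakNormalProduct.map [Finite G] {A B : Subgroup G} (h : IsWeakNormalProduct A B)
    {f : G →* G'} (hf : Function.Surjective f) : IsWeakNormalProduct (A.map f) (B.map f) := by
  refine ⟨?_, h.normal.map f hf, ?_⟩
  · rw [coe_map, coe_map, ← Set.image_mul, h.mul_eq, Set.image_univ, hf.range_eq]
  · intro p _ P' M' hM
    have hs := f.subgroupMap_surjective A
    obtain ⟨P, rfl⟩ := Sylow.mapSurjective_surjective hs p P'
    set φ := f.subgroupMap A with hφ
    have hMφ : (M'.comap φ ⊓ P).map φ = M' := by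
      apply le_antisymm
      · exact (map_mono inf_le_left).trans (map_comap_le _ _)
      · intro y hy
        obtain ⟨x, hx, rfl⟩ := hM.1.le hy
        exact ⟨x, ⟨hy, hx⟩, rfl⟩
    have hcov : M'.comap φ ⊓ P ⋖ (P : Subgroup A) := by
      refine ⟨lt_of_le_of_ne inf_le_right fun he ↦ hM.1.ne ?_, fun K hK hKP ↦ ?_⟩
      · rw [← hMφ, he]; rfl
      · have hle : M' ≤ K.map φ := hMφ ▸ map_mono hK.le
        have hle' : K.map φ ≤ (P : Subgroup A).map φ := map_mono hKP.le
        rcases hM.eq_or_eq hle hle' with he | he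
        · refine hK.not_ge (le_inf ?_ hKP.le)
          rw [← map_le_iff_le_comap, he]
        · refine hKP.not_ge fun x hx ↦ ?_
          obtain ⟨y, hy, hyx⟩ : φ x ∈ K.map φ := he ▸ mem_map_of_mem φ hx
          have : x * y⁻¹ ∈ K := hK.le ⟨by simp [hyx, one_mem],
            (P : Subgroup A).mul_mem hx ((P : Subgroup A).inv_mem (hKP.le hy))⟩
          simpa using mul_mem this hy
    have hp := h.permutes p P _ hcov
    have hmap : M'.map (A.map f).subtype = ((M'.comap φ ⊓ P).map A.subtype).map f := by
      conv_lhs => rw [← hMφ]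
      rw [map_map, map_map]
      rfl
    unfold Permutes at hp ⊢
    rw [hmap, coe_map, coe_map, ← Set.image_mul, hp, Set.image_mul]

theorem commutator_isNilpotent_of_surjective (h : Group.IsNilpotent (commutator G)) {f : G →* G'}
    (hf : Function.Surjective f) : Group.IsNilpotent (commutator G') := by
  have he : (commutator G).map f = commutator G' := by
    rw [commutator_def, map_commutator, map_top_of_surjective f hf, commutator_def]
  rw [← he]
  exact Group.nilpotent_of_surjective _ (f.subgroupMap_surjective _)

end

/-! ### Minimal normal subgroups and power actions -/

namespace Subgroup

variable {G : Type*} [Group G]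

/-- A minimal normal subgroup. -/
structure IsMinimalNormal (V : Subgroup G) : Prop where
  normal : V.Normal
  ne_bot : V ≠ ⊥
  eq_of_le : ∀ W : Subgroup G, W.Normal → W ≤ V → W ≠ ⊥ → W = V

theorem exists_isMinimalNormal_le [Finite G] {A : Subgroup G} (hA : A.Normal) (hA1 : A ≠ ⊥) :
    ∃ V ≤ A, V.IsMinimalNormal := by
  obtain ⟨V, hVA, hV⟩ := Set.Finite.exists_le_minimal
    (Set.toFinite {N : Subgroup G | N.Normal ∧ N ≠ ⊥}) ⟨hA, hA1⟩
  exact ⟨V, hVA, hV.1.1, hV.1.2, fun W hW hWV hW1 ↦ hV.eq_of_le ⟨hW, hW1⟩ hWV⟩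

namespace IsMinimalNormal

variable {V : Subgroup G}

theorem le_or_inf_eq_bot (hV : V.IsMinimalNormal) {W : Subgroup G} (hW : W.Normal) :
    V ≤ W ∨ V ⊓ W = ⊥ := by
  have := hV.normal
  by_cases h : V ⊓ W = ⊥
  · exact .inr h
  · exact .inl (inf_eq_left.1 (hV.eq_of_le _ inferInstance inf_le_left h))

/-- Otherwise [V, G'] = V by minimality, and V lies in every term of the lower central series of G'.
-/
theorem commutator_eq_bot (hV : V.IsMinimalNormal) (hG : Group.IsNilpotent (_root_.commutator G)) :
    ⁅V, _root_.commutator G⁆ = ⊥ := by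
  have := hV.normal
  by_contra h
  have h' := hV.eq_of_le _ inferInstance (commutator_le_left V _) h
  obtain ⟨n, hn⟩ := (isNilpotent_iff_lowerCentralSeries _).1 hG
  have hle : ∀ n, V ≤ (_root_.commutator G).lowerCentralSeries n := by
    intro n
    induction n with
    | zero => exact h' ▸ commutator_le_right V _
    | succ n ih => exact h'.ge.trans (commutator_mono ih le_rfl)
  exact hV.ne_bot (le_bot_iff.1 (hn ▸ hle n))

theorem commute (hV : V.IsMinimalNormal) (hG : Group.IsNilpotent (_root_.commutator G)) {x y : G}
    (hx : x ∈ V) (hy : y ∈ V) : Commute x y := by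
  have := hV.normal
  have hVV : ⁅V, V⁆ = ⊥ := by
    by_contra h
    have h' := hV.eq_of_le _ inferInstance (commutator_le_left V _) h
    have hle : V ≤ _root_.commutator G := h' ▸ commutator_mono le_top le_top
    exact h (le_bot_iff.1 (hV.commutator_eq_bot hG ▸ commutator_mono le_rfl hle))
  exact commutatorElement_eq_one_iff_commute.1
    (mem_bot.1 (hVV ▸ commutator_mem_commutator hx hy))

theorem exists_prime_pow_eq_one [Finite G] (hV : V.IsMinimalNormal)
    (hG : Group.IsNilpotent (_root_.commutator G)) : ∃ q, q.Prime ∧ ∀ x ∈ V, x ^ q = 1 := by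
  have hn := hV.normal
  have hcard : Nat.card V ≠ 1 := fun h ↦ hV.ne_bot (card_eq_one.1 h)
  obtain ⟨q, hq, hdvd⟩ := Nat.exists_prime_and_dvd hcard
  refine ⟨q, hq, ?_⟩
  let W : Subgroup G :=
    { carrier := {x | x ∈ V ∧ x ^ q = 1}
      one_mem' := ⟨one_mem _, one_pow _⟩
      mul_mem' := fun {x y} hx hy ↦ ⟨mul_mem hx.1 hy.1, by
        rw [(hV.commute hG hx.1 hy.1).mul_pow, hx.2, hy.2, one_mul]⟩
      inv_mem' := fun {x} hx ↦ ⟨inv_mem hx.1, by rw [inv_pow, hx.2, inv_one]⟩ }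
  have hW : W.Normal := ⟨fun x hx g ↦ ⟨hn.conj_mem x hx.1 g, by
    rw [conj_pow, hx.2, mul_one, mul_inv_cancel]⟩⟩
  have := Fact.mk hq
  obtain ⟨x, hx⟩ := exists_prime_orderOf_dvd_card' (G := V) q hdvd
  have hWV := hV.eq_of_le W hW (fun x hx ↦ hx.1) (fun h ↦ ?_)
  · intro y hy
    exact (hWV ▸ hy : y ∈ W).2
  · have hxW : (x : G) ∈ W := ⟨x.2, by rw [← hx]; exact_mod_cast pow_orderOf_eq_one x⟩
    rw [h, mem_bot, OneMemClass.coe_eq_one] at hxW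
    rw [hxW, orderOf_one] at hx
    exact hq.one_lt.ne hx

end IsMinimalNormal

/-- The elements normalizing every cyclic subgroup of `V`. -/
def powerNormalizer (V : Subgroup G) : Subgroup G :=
  ⨅ x : V, normalizer (zpowers (x : G) : Set G)

theorem mem_zpowers_of_mem_powerNormalizer {V : Subgroup G} {g x : G}
    (hg : g ∈ V.powerNormalizer) (hx : x ∈ V) : g * x * g⁻¹ ∈ zpowers x :=
  (mem_normalizer_iff.1 (mem_iInf.1 hg ⟨x, hx⟩) x).1 (mem_zpowers x)

theorem mem_powerNormalizer_of_forall [Finite G] {V : Subgroup G} {g : G}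
    (h : ∀ x ∈ V, g * x * g⁻¹ ∈ zpowers x) : g ∈ V.powerNormalizer := by
  refine mem_iInf.2 fun x ↦ ?_
  have hle : (zpowers (x : G)).map (MulAut.conj g).toMonoidHom ≤ zpowers (x : G) := by
    rw [MonoidHom.map_zpowers, zpowers_le]
    exact h x x.2
  have he := eq_of_le_of_card_ge hle
    (card_map_of_injective (MulAut.conj g).injective).ge
  refine mem_normalizer_iff.2 fun y ↦ ⟨fun hy ↦ hle (mem_map_of_mem _ hy), fun hy ↦ ?_⟩
  obtain ⟨z, hz, hzy⟩ := he.ge hy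
  exact (MulAut.conj g).injective hzy ▸ hz

/-- One eigenvector suffices: conjugations by elements of G commute on V, so the eigenspace W is
normal in G and equals V. -/
theorem IsMinimalNormal.mem_powerNormalizer [Finite G] {V : Subgroup G} (hV : V.IsMinimalNormal)
    (hG : Group.IsNilpotent (_root_.commutator G)) {g x : G} {n : ℤ} (hx : x ∈ V) (hx1 : x ≠ 1)
    (h : g * x * g⁻¹ = x ^ n) : g ∈ V.powerNormalizer := by
  have hn := hV.normal
  let W : Subgroup G :=
    { carrier := {x | x ∈ V ∧ g * x * g⁻¹ = x ^ n}
      one_mem' := ⟨one_mem _, by simp⟩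
      mul_mem' := fun {x y} hx hy ↦ ⟨mul_mem hx.1 hy.1, by
        rw [(hV.commute hG hx.1 hy.1).mul_zpow, ← hx.2, ← hy.2]; group⟩
      inv_mem' := fun {x} hx ↦ ⟨inv_mem hx.1, by rw [inv_zpow, ← hx.2]; group⟩ }
  have hW : W.Normal := by
    refine ⟨fun y hy k ↦ ⟨hn.conj_mem y hy.1 k, ?_⟩⟩
    have hc : ⁅y, ⁅g⁻¹, k⁻¹⁆⁆ = 1 := mem_bot.1 (hV.commutator_eq_bot hG ▸
      commutator_mem_commutator hy.1 (commutator_mem_commutator (mem_top _) (mem_top _)))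
    have hc' : ⁅g⁻¹, k⁻¹⁆ * y * ⁅g⁻¹, k⁻¹⁆⁻¹ = y := by
      rw [← (commutatorElement_eq_one_iff_commute.1 hc).eq, mul_inv_cancel_right]
    calc g * (k * y * k⁻¹) * g⁻¹ = k * (g * (⁅g⁻¹, k⁻¹⁆ * y * ⁅g⁻¹, k⁻¹⁆⁻¹) * g⁻¹) * k⁻¹ := by
          simp only [commutatorElement_def]; group
      _ = (k * y * k⁻¹) ^ n := by rw [hc', hy.2, conj_zpow]
  have hWV := hV.eq_of_le W hW (fun x hx ↦ hx.1) fun hb ↦ hx1 (mem_bot.1 (hb ▸ ⟨hx, h⟩))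
  refine mem_powerNormalizer_of_forall fun y hy ↦ ?_
  rw [(hWV ▸ hy : y ∈ W).2]
  exact zpow_mem (mem_zpowers y) n

/-- A `p`-group of conjugations fixes a point of every stable set of order prime to `p`. -/
theorem exists_conj_eq_of_isPGroup {p : ℕ} [Fact p.Prime] {T : Subgroup G} [Finite T]
    (hT : IsPGroup p T) {X : Set G} (hX : ∀ t ∈ T, ∀ x ∈ X, t * x * t⁻¹ ∈ X)
    (hcard : ¬ p ∣ Nat.card X) : ∃ x ∈ X, ∀ t ∈ T, t * x * t⁻¹ = x := by
  let _ : MulAction T X :=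
    { smul := fun t x ↦ ⟨t * x * (t : G)⁻¹, hX t t.2 x x.2⟩
      one_smul := fun x ↦ Subtype.ext (show (1 : G) * x * 1⁻¹ = x by simp)
      mul_smul := fun s t x ↦ Subtype.ext
        (show (s * t : G) * x * (s * t : G)⁻¹ = s * (t * x * (t : G)⁻¹) * (s : G)⁻¹ by group) }
  obtain ⟨x, hx⟩ := hT.nonempty_fixed_point_of_prime_not_dvd_card X hcard
  exact ⟨x, x.2, fun t ht ↦ congrArg Subtype.val (hx ⟨t, ht⟩)⟩

theorem isPGroup_of_forall_pow_eq_one {p : ℕ} {V : Subgroup G} (h : ∀ x ∈ V, x ^ p = 1) :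
    IsPGroup p V :=
  fun x ↦ ⟨1, by rw [pow_one]; exact Subtype.ext (h x x.2)⟩

/-- |V \ {1}| = q^k - 1 is prime to q, so T fixes a nontrivial element: an eigenvector with n = 1.
-/
theorem IsMinimalNormal.le_powerNormalizer_of_isPGroup [Finite G] {V : Subgroup G}
    (hV : V.IsMinimalNormal) (hG : Group.IsNilpotent (_root_.commutator G)) {q : ℕ} [Fact q.Prime]
    (hq : IsPGroup q V) {T : Subgroup G} (hT : IsPGroup q T) : T ≤ V.powerNormalizer := by
  have := hV.normal
  obtain ⟨k, hk⟩ := IsPGroup.iff_card.1 hq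
  have hk0 : k ≠ 0 := by
    rintro rfl
    exact hV.ne_bot (card_eq_one.1 hk)
  obtain ⟨x, hx, hfix⟩ := exists_conj_eq_of_isPGroup hT (X := (V : Set G) \ {1})
    (fun t _ x hx ↦ ⟨this.conj_mem x hx.1 t, by simpa using hx.2⟩) (by
      have h1 : Nat.card ((V : Set G) \ {1} : Set G) + 1 = q ^ k := by
        rw [← hk, Nat.card_coe_set_eq,
          Set.ncard_sdiff_singleton_add_one (one_mem V) (Set.toFinite _)]
        exact (Nat.card_coe_set_eq _).symm
      intro hdvd
      have h2 := (Nat.dvd_add_right hdvd).1 (h1 ▸ dvd_pow_self q hk0)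
      exact (Fact.out : q.Prime).one_lt.ne' (Nat.dvd_one.1 h2))
  intro t ht
  exact hV.mem_powerNormalizer hG hx.1 hx.2 (n := 1) (by rw [hfix t ht, zpow_one])

theorem eq_top_of_forall_sylow_le [Finite G] {H : Subgroup G}
    (h : ∀ (p : ℕ) [Fact p.Prime], ∃ P : Sylow p G, (P : Subgroup G) ≤ H) : H = ⊤ := by
  by_contra hH
  obtain ⟨p, hp, hdvd⟩ := Nat.exists_prime_and_dvd (mt index_eq_one.1 hH)
  have := Fact.mk hp
  obtain ⟨P, hP⟩ := h p
  exact P.not_dvd_index (hdvd.trans (index_dvd_of_le hP))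

/-- Sylow subgroups generate K. For p ≠ q, a Sylow p-subgroup is ℙ-subnormal in K and avoids V ∩ K,
hence has an eigenvector there. -/
theorem IsMinimalNormal.le_powerNormalizer_of_isWSupersoluble [Finite G] {V : Subgroup G}
    (hV : V.IsMinimalNormal) (hG : Group.IsNilpotent (_root_.commutator G)) {q : ℕ} [Fact q.Prime]
    (hq : IsPGroup q V) {K : Subgroup G} (hK : IsWSupersoluble K) (hVK : V ⊓ K ≠ ⊥) :
    K ≤ V.powerNormalizer := by
  have := hV.normal
  refine subgroupOf_eq_top.1 (eq_top_of_forall_sylow_le fun p _ ↦ ?_)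
  let T : Sylow p K := default
  refine ⟨T, ?_⟩
  rw [subgroupOf, ← map_le_iff_le_comap]
  by_cases hpq : p = q
  · subst hpq
    exact hV.le_powerNormalizer_of_isPGroup hG hq (T.2.map _)
  · have hN : V.subgroupOf K ≠ ⊥ := by
      rwa [Ne, subgroupOf_eq_bot, disjoint_iff]
    have hd : V.subgroupOf K ⊓ T = ⊥ :=
      (IsPGroup.disjoint_of_ne q p (Ne.symm hpq) _ _ hq.comap_subtype T.2).eq_bot
    obtain ⟨x, hxV, hx1, hx⟩ := (hK p T).exists_zpowers_eq hN hd
    rintro _ ⟨t, ht, rfl⟩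
    obtain ⟨n, hn⟩ := hx t ht
    exact hV.mem_powerNormalizer hG hxV (by simpa using hx1)
      (by simpa using congrArg Subtype.val hn)

theorem powerNormalizer_le_normalizer {U V : Subgroup G} (hUV : U ≤ V) :
    V.powerNormalizer ≤ normalizer (U : Set G) := by
  intro g hg
  refine mem_normalizer_iff.2 fun x ↦ ⟨fun hx ↦ ?_, fun hx ↦ ?_⟩
  · exact zpowers_le.2 hx (mem_zpowers_of_mem_powerNormalizer hg (hUV hx))
  · have h := zpowers_le.2 hx (mem_zpowers_of_mem_powerNormalizer (inv_mem hg) (hUV hx))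
    simpa [mul_assoc] using h

theorem card_sup_of_disjoint {H N : Subgroup G} (h : Disjoint H N)
    (hN : H ≤ normalizer (N : Set G)) :
    Nat.card (H ⊔ N : Subgroup G) = Nat.card H * Nat.card N := by
  rw [← Nat.card_prod, ← Nat.card_range_of_injective (mul_injective_of_disjoint h)]
  refine Nat.card_congr (Equiv.setCongr (s := ((H ⊔ N : Subgroup G) : Set G)) ?_)
  rw [coe_mul_of_left_le_normalizer_right H N hN]
  ext x
  simp [Set.mem_mul]

theorem reflTransGen_primeStep_sup [Finite G] {P V : Subgroup G} {q : ℕ} [hq : Fact q.Prime]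
    (hP : P ≤ V.powerNormalizer) (hd : Disjoint P V)
    (hc : ∀ x ∈ V, ∀ y ∈ V, Commute x y) (he : ∀ x ∈ V, x ^ q = 1) :
    Relation.ReflTransGen PrimeStep P (P ⊔ V) := by
  -- Take U maximal in V such that PU is reachable from P. For x ∈ V outside U, passing to P⟨x⟩U
  -- would be one more step, of index q.
  obtain ⟨U, -, hU⟩ := Set.Finite.exists_le_maximal
    (Set.toFinite {U : Subgroup G | U ≤ V ∧ Relation.ReflTransGen PrimeStep P (P ⊔ U)})
    (a := ⊥) ⟨bot_le, by rw [sup_bot_eq]⟩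
  by_cases hUV : V ≤ U
  · rw [le_antisymm hUV hU.1.1]; exact hU.1.2
  obtain ⟨x, hxV, hxU⟩ := Set.not_subset.1 hUV
  have hle : zpowers x ⊔ U ≤ V := sup_le (zpowers_le.2 hxV) hU.1.1
  have hcx : Nat.card (zpowers x) = q := by
    rw [Nat.card_zpowers]
    exact orderOf_eq_prime (he x hxV) fun h ↦ hxU (h ▸ one_mem U)
  have hdx : Disjoint (zpowers x) U := by
    have := Fact.mk (hcx ▸ hq.out : (Nat.card (zpowers x)).Prime)
    rcases (U.subgroupOf (zpowers x)).eq_bot_or_eq_top_of_prime_card with h | h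
    · exact (subgroupOf_eq_bot.1 h).symm
    · exact absurd (subgroupOf_eq_top.1 h (mem_zpowers x)) hxU
  have hnx : zpowers x ≤ normalizer (U : Set G) := by
    intro y hy
    have hyV := zpowers_le.2 hxV hy
    refine (powerNormalizer_le_normalizer hU.1.1) (mem_powerNormalizer_of_forall fun z hz ↦ ?_)
    rw [(hc y hyV z hz).eq, mul_inv_cancel_right]
    exact mem_zpowers z
  have h1 := card_sup_of_disjoint hdx hnx
  have h2 := card_sup_of_disjoint (hd.mono_right hle) (hP.trans (powerNormalizer_le_normalizer hle))
  have h3 := card_sup_of_disjoint (hd.mono_right hU.1.1)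
    (hP.trans (powerNormalizer_le_normalizer hU.1.1))
  have hPU : P ⊔ U ≤ P ⊔ (zpowers x ⊔ U) := sup_le_sup_left le_sup_right P
  have h4 := relIndex_mul_relIndex ⊥ (P ⊔ U) _ bot_le hPU
  rw [relIndex_bot_left, relIndex_bot_left, h2, h3, h1, hcx, mul_left_comm, mul_comm,
    Nat.mul_left_inj (Nat.mul_pos Nat.card_pos Nat.card_pos).ne'] at h4
  have h5 := hU.le_of_ge ⟨hle, hU.1.2.tail ⟨hPU, h4 ▸ hq.out⟩⟩ le_sup_right
  exact absurd (h5 (mem_sup_left (mem_zpowers x))) hxU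

theorem inf_sup_le_of_isPGroup {p q : ℕ} [Fact p.Prime] [Fact q.Prime] (hpq : p ≠ q)
    {P Q W : Subgroup G} [W.Normal] (hP : IsPGroup p P) (hQ : IsPGroup q Q) :
    Q ⊓ (P ⊔ W) ≤ W := by
  set f := QuotientGroup.mk' W with hf
  have hd := (IsPGroup.disjoint_of_ne q p hpq.symm _ _ (hQ.map f) (hP.map f)).eq_bot
  have hk : f.ker = W := QuotientGroup.ker_mk' W
  intro x hx
  rw [← hk, MonoidHom.mem_ker, ← mem_bot, ← hd]
  refine ⟨mem_map_of_mem f hx.1, ?_⟩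
  have h := mem_map_of_mem f hx.2
  rwa [map_sup, (map_eq_bot_iff W).2 hk.ge, sup_bot_eq] at h

/-! ### Actions on sections of order q, and eigenvectors -/

theorem _root_.IsPGroup.normal_of_prime_index {q : ℕ} [hq : Fact q.Prime] [Finite G]
    (hG : IsPGroup q G) {M : Subgroup G} (hM : M.index = q) : M.Normal := by
  obtain ⟨k, hk⟩ := IsPGroup.iff_card.1 hG
  refine normal_of_index_eq_minFac_card ?_
  have hk0 : k ≠ 0 := by
    rintro rfl
    have h := M.index_dvd_card
    rw [hk, hM, pow_zero, Nat.dvd_one] at h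
    exact hq.out.one_lt.ne' h
  rw [hM, hk, hq.out.pow_minFac hk0]

theorem _root_.IsPGroup.index_of_isCoatom {q : ℕ} [hq : Fact q.Prime] [Finite G]
    (hG : IsPGroup q G) {M : Subgroup G} (hM : IsCoatom M) : M.index = q := by
  obtain ⟨k, hk⟩ := IsPGroup.iff_card.1 hG
  obtain ⟨n, hn⟩ := IsPGroup.iff_card.1 (hG.to_subgroup M)
  obtain ⟨m, hm⟩ := IsPGroup.index hG M
  have hc := M.card_mul_index
  have hm0 : m ≠ 0 := by
    rintro rfl
    exact hM.1 (index_eq_one.1 hm)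
  have hdvd : q ^ (n + 1) ∣ Nat.card G := by
    rw [← hc, hn, hm, ← pow_add]
    exact pow_dvd_pow q (by omega)
  obtain ⟨K, hK, hMK⟩ := Sylow.exists_subgroup_card_pow_succ hdvd hn
  have hlt : M < K := lt_of_le_of_ne hMK (by
    rintro rfl
    exact (Nat.pow_lt_pow_succ hq.out.one_lt).ne (hn.symm.trans hK))
  rw [hM.2 K hlt, card_top, ← hc, hn, pow_succ] at hK
  exact Nat.eq_of_mul_eq_mul_left (pow_pos hq.out.pos n) hK

/-- An automorphism `φ` of `X` acts on a stable section of prime order `q` as a power map, so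
`φ ^ (q - 1)` centralizes that section. -/
theorem mulAut_pow_apply_mul_inv_mem {X : Type*} [Group X] {q : ℕ} [hq : Fact q.Prime]
    {N : Subgroup X} [N.Normal] (hN : N.index = q) (φ : MulAut X) (hφ : ∀ x ∈ N, φ x ∈ N) (x : X) :
    (φ ^ (q - 1)) x * x⁻¹ ∈ N := by
  have hcard : Nat.card (X ⧸ N) = q := by rw [← index_eq_card, hN]
  have := isCyclic_of_prime_card hcard
  obtain ⟨m, hm⟩ := (QuotientGroup.map N N φ.toMonoidHom hφ).map_cyclic
  have hm' : ∀ y : X, ((φ y : X) : X ⧸ N) = (y : X ⧸ N) ^ m := fun y ↦ hm y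
  have hpow : ∀ k : ℕ, (((φ ^ k) x : X) : X ⧸ N) = (x : X ⧸ N) ^ (m ^ k) := by
    intro k
    induction k with
    | zero => simp
    | succ k ih => rw [pow_succ', MulAut.mul_apply, hm', ih, ← zpow_mul, pow_succ]
  -- φ is onto, so the power map is not trivial on the quotient; Fermat then applies to m.
  have hqm : ¬ (q : ℤ) ∣ m := by
    rintro ⟨c, rfl⟩
    have h1 : ∀ y : X, ((y : X) : X ⧸ N) = 1 := by
      intro y
      have h := hm' (φ⁻¹ y)
      rw [MulAut.apply_inv_self, zpow_mul, zpow_natCast, ← hcard, pow_card_eq_one',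
        one_zpow] at h
      exact h
    have h2 : Nat.card (X ⧸ N) = 1 :=
      Nat.card_eq_one_iff_unique.2 ⟨⟨fun a b ↦ by
        induction a using QuotientGroup.induction_on
        induction b using QuotientGroup.induction_on
        rw [h1, h1]⟩, ⟨1⟩⟩
    exact hq.out.one_lt.ne' (hcard.symm.trans h2)
  have hmod : m ^ (q - 1) ≡ 1 [ZMOD q] := Int.ModEq.pow_card_sub_one_eq_one hq.out
    ((Prime.coprime_iff_not_dvd (Nat.prime_iff_prime_int.1 hq.out)).2 hqm).symm
  have hfin : (((φ ^ (q - 1)) x : X) : X ⧸ N) = x := by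
    rw [hpow]
    conv_rhs => rw [← zpow_one (x : X ⧸ N)]
    rw [zpow_eq_zpow_iff_modEq]
    have hord : orderOf (x : X ⧸ N) ∣ q := by
      rw [← hcard]
      exact _root_.orderOf_dvd_natCard (x : X ⧸ N)
    exact hmod.of_dvd (by exact_mod_cast hord)
  rw [← QuotientGroup.eq_one_iff, QuotientGroup.mk_mul, QuotientGroup.mk_inv, hfin,
    mul_inv_cancel]

/-- An automorphism of order dividing `q - 1` of a nontrivial elementary abelian `q`-group has an
eigenvector. -/
theorem exists_apply_eq_zpow {X : Type*} [CommGroup X] [Finite X] [Nontrivial X] {q : ℕ}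
    [hq : Fact q.Prime] (he : ∀ x : X, x ^ q = 1) (φ : X →* X) (hφ : ∀ x, φ^[q - 1] x = x) :
    ∃ x ≠ 1, ∃ n : ℤ, φ x = x ^ n := by
  let _ : Module (ZMod q) (Additive X) := AddCommGroup.zmodModule (n := q) fun x ↦ he x.toMul
  have : FiniteDimensional (ZMod q) (Additive X) := Module.Finite.of_finite
  set f : Module.End (ZMod q) (Additive X) := AddMonoidHom.toZModLinearMap q φ.toAdditive with hf
  have hpow : ∀ (k : ℕ) (x : X), (f ^ k) (Additive.ofMul x) = Additive.ofMul (φ^[k] x) := by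
    intro k
    induction k with
    | zero => intro x; rfl
    | succ k ih =>
      intro x
      rw [pow_succ, Module.End.mul_apply, Function.iterate_succ_apply]
      exact ih _
  have hf1 : f ^ (q - 1) = 1 := LinearMap.ext fun x ↦ (hpow _ _).trans (hφ _)
  have hfq : Polynomial.aeval f (Polynomial.X ^ Fintype.card (ZMod q) - Polynomial.X :
      Polynomial (ZMod q)) = 0 := by
    -- The minimal polynomial therefore divides X^q - X, which splits over the field of q elements.
    have h : f ^ q = f := by
      rw [← mul_pow_sub_one hq.out.ne_zero, hf1, mul_one]
    rw [map_sub, map_pow, Polynomial.aeval_X, ZMod.card, h, sub_self]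
  have hdvd := minpoly.dvd _ f hfq
  have hsp := (FiniteField.splits_X_pow_card_sub_X (p := q) (K := ZMod q))
  rw [Algebra.algebraMap_self, Polynomial.map_id] at hsp
  have hsp' := hsp.of_dvd (FiniteField.X_pow_card_sub_X_ne_zero _ Fintype.one_lt_card) hdvd
  obtain ⟨μ, hμ⟩ := hsp'.exists_eval_eq_zero
    (minpoly.degree_pos (Algebra.IsIntegral.isIntegral f)).ne'
  obtain ⟨v, hv⟩ := (Module.End.hasEigenvalue_of_isRoot hμ).exists_hasEigenvector
  refine ⟨v.toMul, fun h ↦ hv.2 h, (μ.val : ℕ), ?_⟩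
  have h := hv.apply_eq_smul
  rw [← ZMod.natCast_zmod_val μ, Nat.cast_smul_eq_nsmul] at h
  rw [zpow_natCast]
  exact h

/-- Conjugation by an element normalizing `R` and `R₁` acts on the section `R / R₁` of order `q`
with order dividing `q - 1`. -/
theorem conj_pow_mul_inv_mem [Finite G] {q : ℕ} [hq : Fact q.Prime] {R R₁ : Subgroup G}
    (hR : IsPGroup q R) (hidx : R₁.relIndex R = q) {g : G} (hgR : g ∈ normalizer (R : Set G))
    (hgR₁ : ∀ x ∈ R₁, g * x * g⁻¹ ∈ R₁) {x : G} (hx : x ∈ R) :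
    g ^ (q - 1) * x * (g ^ (q - 1))⁻¹ * x⁻¹ ∈ R₁ := by
  have := hR.normal_of_prime_index (M := R₁.subgroupOf R) hidx
  have h := mulAut_pow_apply_mul_inv_mem (N := R₁.subgroupOf R) hidx
    (R.normalizerMonoidHom ⟨g, hgR⟩) (fun x hx ↦ hgR₁ x hx) ⟨x, hx⟩
  rw [← map_pow] at h
  exact h

/-- Let `P` be a `p`-subgroup such that `P ⊔ V` and `C` are joined by steps of prime index.
For `g ∈ P`, the elements of the normal `q`-subgroup `Q` inside `C` are products of elements of `V`
and of fixed points of `g ^ (q - 1)`. -/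
theorem exists_mul_fixed_of_reflTransGen [Finite G] {p q : ℕ} [hp : Fact p.Prime]
    [hq : Fact q.Prime] (hpq : p ≠ q) {P Q V C : Subgroup G} [hQn : Q.Normal] [V.Normal]
    (hP : IsPGroup p P) (hQ : IsPGroup q Q)
    (hC : Relation.ReflTransGen PrimeStep (P ⊔ V) C) {g : G} (hg : g ∈ P) :
    ∀ x ∈ Q ⊓ C, ∃ v ∈ V, ∃ c ∈ Q, x = v * c ∧ g ^ (q - 1) * c * (g ^ (q - 1))⁻¹ = c := by
  induction hC with
  | refl =>
    exact fun x hx ↦ ⟨x, inf_sup_le_of_isPGroup hpq hP hQ hx, 1, one_mem Q, by simp, by simp⟩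
  | @tail C C' hPC hCC' ih =>
    intro x hx
    have hPle : P ≤ C := by
      refine le_sup_left.trans (b := P ⊔ V) ?_
      clear ih hCC' hx
      induction hPC with
      | refl => exact le_rfl
      | tail _ h ih => exact ih.trans h.1
    have hRq : IsPGroup q (Q ⊓ C' : Subgroup G) := hQ.to_le inf_le_left
    have hdvd := relIndex_inf_dvd_relIndex C Q C'
    have hrel : (Q ⊓ C).relIndex (Q ⊓ C') = C.relIndex (Q ⊓ C') := by
      rw [← inf_relIndex_right (Q ⊓ C), ← inf_relIndex_right C]
      congr 1
      rw [inf_comm (Q ⊓ C), inf_comm C, inf_assoc, inf_assoc, inf_left_comm C', ← inf_assoc Q Q,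
        inf_idem]
    rw [← hrel] at hdvd
    rcases (Nat.dvd_prime hCC'.2).1 hdvd with h1 | h1
    · exact ih x (relIndex_eq_one.1 h1 hx)
    · obtain ⟨k, hk⟩ := hRq.index ((Q ⊓ C).subgroupOf (Q ⊓ C'))
      have hidx : (Q ⊓ C).relIndex (Q ⊓ C') = q := by
        have hpr : (q ^ k).Prime := hk ▸ (h1 ▸ hCC'.2 : ((Q ⊓ C).relIndex (Q ⊓ C')).Prime)
        have hk1 : k = 1 := hpr.eq_one_of_pow
        rw [relIndex, hk, hk1, pow_one]
      have hconj : ∀ (D : Subgroup G), P ≤ D → ∀ t ∈ P, ∀ y ∈ Q ⊓ D, t * y * t⁻¹ ∈ Q ⊓ D :=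
        fun D hD t ht y hy ↦
          ⟨hQn.conj_mem y hy.1 t, D.mul_mem (D.mul_mem (hD ht) hy.2) (D.inv_mem (hD ht))⟩
      have hnorm : ∀ t ∈ P, t ∈ normalizer ((Q ⊓ C' : Subgroup G) : Set G) := by
        intro t ht
        refine mem_normalizer_iff.2 fun y ↦ ⟨hconj _ (hPle.trans hCC'.1) t ht y, fun hy ↦ ?_⟩
        simpa [mul_assoc] using hconj _ (hPle.trans hCC'.1) t⁻¹ (inv_mem ht) _ hy
      have hT : zpowers (g ^ (q - 1)) ≤ P := zpowers_le.2 (pow_mem hg _)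
      -- Powers of g^(q-1) act trivially on the section, so the p-group ⟨g^(q-1)⟩ stabilizes the
      -- coset (Q ∩ C)x. Its size is a power of q, so it has a fixed point rx.
      obtain ⟨_, ⟨r, hr, rfl⟩, hfix⟩ := exists_conj_eq_of_isPGroup (hP.to_le hT)
        (X := (fun r ↦ r * x) '' (Q ⊓ C : Subgroup G)) (by
          rintro t ht _ ⟨r, hr, rfl⟩
          refine ⟨t * r * t⁻¹ * (t * x * t⁻¹ * x⁻¹),
            mul_mem (hconj C hPle t (hT ht) r hr) ?_, by group⟩
          obtain ⟨n, rfl⟩ := mem_zpowers_iff.1 ht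
          have := conj_pow_mul_inv_mem hRq hidx (hnorm _ (zpow_mem hg n))
            (hconj C hPle _ (zpow_mem hg n)) hx
          rwa [← zpow_natCast, ← zpow_mul, mul_comm, zpow_mul, zpow_natCast] at this) (by
          obtain ⟨m, hm⟩ := IsPGroup.iff_card.1 (hQ.to_le (inf_le_left : Q ⊓ C ≤ Q))
          rw [Nat.card_image_of_injective (mul_left_injective x)]
          intro h
          exact hpq ((Nat.prime_dvd_prime_iff_eq hp.out hq.out).1
            (hp.out.dvd_of_dvd_pow (hm ▸ h : p ∣ q ^ m))))
      -- Writing r⁻¹ = vc gives x = v(c · rx), with both c and rx fixed.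
      obtain ⟨v, hv, c, hcQ, hrc, hcfix⟩ := ih r⁻¹ (inv_mem hr)
      have hrx : r * x ∈ Q := mul_mem hr.1 hx.1
      exact ⟨v, hv, c * (r * x), mul_mem hcQ hrx, by rw [← mul_assoc, ← hrc]; group, by
        calc _ = (g ^ (q - 1) * c * (g ^ (q - 1))⁻¹) *
              (g ^ (q - 1) * (r * x) * (g ^ (q - 1))⁻¹) := by group
          _ = _ := by rw [hcfix, hfix _ (mem_zpowers _)]⟩

/-- If every maximal subgroup of the normal `q`-subgroup `Q` contains `V`, then `p`-elements act on
`V` as power maps as soon as `P ⊔ V` is `ℙ`-subnormal. -/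
theorem IsMinimalNormal.le_powerNormalizer_of_forall_covBy [Finite G] {V : Subgroup G}
    (hV : V.IsMinimalNormal) (hG : Group.IsNilpotent (_root_.commutator G)) {p q : ℕ}
    [hp : Fact p.Prime] [hq : Fact q.Prime] (hpq : p ≠ q) (he : ∀ x ∈ V, x ^ q = 1)
    {P Q : Subgroup G} (hQn : Q.Normal) (hVQ : V ≤ Q) (hP : IsPGroup p P) (hQ : IsPGroup q Q)
    (hPV : (P ⊔ V).IsPSubnormal) (hM : ∀ M, M ⋖ Q → V ≤ M) : P ≤ V.powerNormalizer := by
  intro g hg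
  have hVn := hV.normal
  let D : Subgroup G := centralizer {g ^ (q - 1)} ⊓ Q
  have hDmem : ∀ c, c ∈ D ↔ g ^ (q - 1) * c * (g ^ (q - 1))⁻¹ = c ∧ c ∈ Q := fun c ↦ by
    rw [mem_inf, mem_centralizer_singleton_iff, mul_inv_eq_iff_eq_mul, eq_comm]
  -- A proper D lies in a maximal M of Q; since V ≤ M too, Q = VD ≤ M, which is absurd.
  have hDQ : Q ≤ D := by
    by_contra hne
    obtain ⟨M, hMc, hDM, hMQ⟩ : ∃ M, M ⋖ Q ∧ D ≤ M ∧ M ≤ Q := by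
      obtain ⟨M, hDM, hM⟩ := Set.Finite.exists_le_maximal
        (Set.toFinite {M : Subgroup G | M < Q}) (a := D)
        (lt_of_le_of_ne inf_le_right fun h ↦ hne h.ge)
      exact ⟨M, ⟨hM.1, fun K hMK hKQ ↦ hMK.not_ge (hM.le_of_ge hKQ hMK.le)⟩, hDM, hM.1.le⟩
    refine hMc.1.not_ge fun x hx ↦ ?_
    obtain ⟨v, hv, c, hcQ, rfl, hc⟩ := exists_mul_fixed_of_reflTransGen hpq hP hQ
      (isPSubnormal_iff_reflTransGen.1 hPV) hg x ⟨hx, mem_top x⟩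
    exact mul_mem (hM M hMc hv) (hDM ((hDmem c).2 ⟨hc, hcQ⟩))
  let _ : CommGroup V :=
    { (inferInstance : Group V) with
      mul_comm := fun x y ↦ Subtype.ext (hV.commute hG x.2 y.2) }
  have : Nontrivial V := V.nontrivial_iff_ne_bot.2 hV.ne_bot
  have hpow : ∀ (k : ℕ) (x : V), (((MulAut.conjNormal g : MulAut V).toMonoidHom^[k] x : V) : G) =
      g ^ k * x * (g ^ k)⁻¹ := by
    intro k
    induction k with
    | zero => intro x; simp
    | succ k ih =>
      intro x
      rw [Function.iterate_succ_apply, ih]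
      simp only [MulEquiv.toMonoidHom_eq_coe, MonoidHom.coe_coe, MulAut.conjNormal_apply]
      group
  obtain ⟨x, hx1, n, hn⟩ := exists_apply_eq_zpow (X := V) (fun x ↦ Subtype.ext (he x x.2))
    (MulAut.conjNormal g : MulAut V).toMonoidHom
    fun x ↦ Subtype.ext ((hpow _ x).trans ((hDmem x).1 (hDQ (hVQ x.2))).1)
  exact hV.mem_powerNormalizer hG x.2 (by simpa using hx1)
    (by simpa using congrArg Subtype.val hn)

/-! ### The elementary abelian case -/

/-- A normal `q`-subgroup with a core-free maximal subgroup is elementary abelian. -/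
theorem commute_and_pow_eq_one_of_covBy [Finite G] {q : ℕ} [hq : Fact q.Prime]
    {Q M : Subgroup G} [hQn : Q.Normal] (hQ : IsPGroup q Q) (hM : M ⋖ Q)
    (hcore : M.normalCore = ⊥) :
    (∀ x ∈ Q, ∀ y ∈ Q, Commute x y) ∧ ∀ x ∈ Q, x ^ q = 1 := by
  have hco : IsCoatom (M.subgroupOf Q) := by
    refine ⟨fun h ↦ hM.1.not_ge (subgroupOf_eq_top.1 h), fun K hK ↦ ?_⟩
    have hMK : M ≤ K.map Q.subtype := fun x hx ↦ ⟨⟨x, hM.1.le hx⟩, hK.le hx, rfl⟩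
    rcases hM.eq_or_eq hMK (map_subtype_le K) with h | h
    · refine absurd hK.le (hK.not_ge ?_).elim
      rw [← h]
      exact fun x hx ↦ mem_map_of_mem _ hx
    · refine eq_top_iff.2 fun x _ ↦ ?_
      obtain ⟨y, hy, hyx⟩ := h.ge x.2
      exact (Subtype.ext hyx : y = x) ▸ hy
  have hidx := hQ.index_of_isCoatom hco
  have hn := hQ.normal_of_prime_index hidx
  have hcyc : IsCyclic (Q ⧸ M.subgroupOf Q) := isCyclic_of_prime_card (p := q) hidx
  -- Q/M has order q, so M contains all commutators and q-th powers from Q. Conjugates of these have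
  -- the same form, so they lie in the trivial core.
  have hcommM : ∀ x ∈ Q, ∀ y ∈ Q, ⁅x, y⁆ ∈ M := by
    intro x hx y hy
    have h : (⁅(⟨x, hx⟩ : Q), ⟨y, hy⟩⁆ : Q) ∈ M.subgroupOf Q := by
      rw [← QuotientGroup.eq_one_iff]
      change ⁅((⟨x, hx⟩ : Q) : Q ⧸ M.subgroupOf Q), ((⟨y, hy⟩ : Q) : Q ⧸ M.subgroupOf Q)⁆ = 1
      exact commutatorElement_eq_one_iff_commute.2 (IsCyclic.commGroup.mul_comm _ _)
    exact h
  have hpowM : ∀ x ∈ Q, x ^ q ∈ M := by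
    intro x hx
    have h := pow_index_mem (M.subgroupOf Q) (⟨x, hx⟩ : Q)
    rw [hidx] at h
    exact h
  constructor
  · intro x hx y hy
    rw [← commutatorElement_eq_one_iff_commute, ← mem_bot, ← hcore]
    intro g
    have h := hcommM _ (hQn.conj_mem x hx g) _ (hQn.conj_mem y hy g)
    rwa [← conjugate_commutatorElement] at h
  · intro x hx
    rw [← mem_bot, ← hcore]
    intro g
    rw [← conj_pow]
    exact hpowM _ (hQn.conj_mem x hx g)

/-- In an elementary abelian subgroup `Q`, for every `v ∉ D` there is a maximal subgroup of `Q`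
containing `D` but not `v`. -/
theorem exists_covBy_notMem [Finite G] {q : ℕ} [hq : Fact q.Prime] {Q D : Subgroup G}
    (hc : ∀ x ∈ Q, ∀ y ∈ Q, Commute x y) (he : ∀ x ∈ Q, x ^ q = 1) (hDQ : D ≤ Q) {v : G}
    (hvQ : v ∈ Q) (hvD : v ∉ D) :
    ∃ M, M ⋖ Q ∧ D ≤ M ∧ v ∉ M ∧ ∀ x ∈ Q, ∃ m ∈ M, ∃ n : ℤ, x = m * v ^ n := by
  obtain ⟨M, hDM, hM⟩ := Set.Finite.exists_le_maximal
    (Set.toFinite {M : Subgroup G | M ≤ Q ∧ v ∉ M}) (a := D) ⟨hDQ, hvD⟩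
  have hex : ∀ x ∈ Q, ∃ m ∈ M, ∃ n : ℤ, x = m * v ^ n := by
    intro x hx
    by_cases hxM : x ∈ M
    · exact ⟨x, hxM, 0, by simp⟩
    -- K = M⟨x⟩ contains v by maximality; in v = m xⁿ the exponent n is prime to q, so Bézout solves
    -- for x.
    let K : Subgroup G :=
      { carrier := {y | ∃ m ∈ M, ∃ n : ℤ, y = m * x ^ n}
        one_mem' := ⟨1, one_mem M, 0, by simp⟩
        mul_mem' := by
          rintro _ _ ⟨m, hm, n, rfl⟩ ⟨m', hm', n', rfl⟩
          refine ⟨m * m', mul_mem hm hm', n + n', ?_⟩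
          rw [zpow_add, mul_assoc, ← mul_assoc (x ^ n),
            (hc _ (zpow_mem hx n) _ (hM.1.1 hm')).eq]
          group
        inv_mem' := by
          rintro _ ⟨m, hm, n, rfl⟩
          refine ⟨m⁻¹, inv_mem hm, -n, ?_⟩
          rw [mul_inv_rev, ← zpow_neg, (hc _ (zpow_mem hx _) _ (inv_mem (hM.1.1 hm))).eq] }
    have hKQ : K ≤ Q := by
      rintro _ ⟨m, hm, n, rfl⟩
      exact mul_mem (hM.1.1 hm) (zpow_mem hx n)
    have hMK : M ≤ K := fun m hm ↦ ⟨m, hm, 0, by simp⟩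
    have hvK : v ∈ K := by
      by_contra hvK
      exact hxM (hM.le_of_ge ⟨hKQ, hvK⟩ hMK ⟨1, one_mem M, 1, by simp⟩)
    obtain ⟨m, hm, n, hv⟩ := hvK
    have hqn : ¬ (q : ℤ) ∣ n := by
      rintro ⟨c, rfl⟩
      rw [zpow_mul, zpow_natCast, he x hx, one_zpow, mul_one] at hv
      exact hM.1.2 (hv ▸ hm)
    obtain ⟨a, b, hab⟩ := (Prime.coprime_iff_not_dvd (Nat.prime_iff_prime_int.1 hq.out)).2 hqn
    refine ⟨(m ^ b)⁻¹, inv_mem (zpow_mem hm b), b, ?_⟩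
    rw [hv, (hc _ (hM.1.1 hm) _ (zpow_mem hx n)).mul_zpow, inv_mul_cancel_left, ← zpow_mul,
      mul_comm n b]
    conv_lhs => rw [← zpow_one x, ← hab, zpow_add, mul_comm a, zpow_mul, zpow_natCast, he x hx,
      one_zpow, one_mul]
  refine ⟨M, ⟨lt_of_le_of_ne hM.1.1 fun h ↦ hM.1.2 (h ▸ hvQ), fun K hMK hKQ ↦ ?_⟩, hDM, hM.1.2,
    hex⟩
  have hvK : v ∈ K := by
    by_contra hvK
    exact hMK.not_ge (hM.le_of_ge ⟨hKQ.le, hvK⟩ hMK.le)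
  refine hKQ.not_ge fun x hx ↦ ?_
  obtain ⟨m, hm, n, rfl⟩ := hex x hx
  exact mul_mem (hMK.le hm) (zpow_mem hvK n)

/-- A subgroup `B` permuting with all maximal subgroups of the elementary abelian normal subgroup
`Q` acts by power maps on a minimal normal subgroup `V ≤ Q` that it avoids. -/
theorem IsMinimalNormal.le_powerNormalizer_of_permutes [Finite G] {V : Subgroup G}
    (hV : V.IsMinimalNormal) (hG : Group.IsNilpotent (_root_.commutator G)) {q : ℕ}
    [hq : Fact q.Prime] {Q B : Subgroup G} (hQn : Q.Normal) (hVQ : V ≤ Q)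
    (hc : ∀ x ∈ Q, ∀ y ∈ Q, Commute x y) (he : ∀ x ∈ Q, x ^ q = 1) (hVB : V ⊓ B = ⊥)
    (hB : ∀ M, M ⋖ Q → B.Permutes M) : B ≤ V.powerNormalizer := by
  have hVn := hV.normal
  obtain ⟨v, hvV, hv1⟩ := V.bot_or_exists_ne_one.resolve_left hV.ne_bot
  obtain ⟨M, hMc, hDM, hvM, hex⟩ := exists_covBy_notMem hc he (inf_le_right : B ⊓ Q ≤ Q)
    (hVQ hvV) (fun h ↦ hv1 (by rw [← mem_bot, ← hVB]; exact ⟨hvV, h.1⟩))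
  have hMB := hB M hMc
  intro b hb
  -- Write bx = mb' with m ∈ M, b' ∈ B. Then b'b⁻¹ ∈ B ∩ Q ≤ M, so bxb⁻¹ = m b'b⁻¹ ∈ M.
  have hstab : ∀ x ∈ V, x ∈ M → b * x * b⁻¹ ∈ M := by
    intro x hxV hxM
    obtain ⟨m, hm, b', hb', hmb⟩ : b * x ∈ (M : Set G) * (B : Set G) :=
      hMB ▸ Set.mul_mem_mul hb hxM
    have hmb' : m * b' = b * x := hmb
    have hcj : b' * b⁻¹ = m⁻¹ * (b * x * b⁻¹) := by
      rw [← hmb']; group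
    have hd : b' * b⁻¹ ∈ M := hDM ⟨B.mul_mem hb' (B.inv_mem hb), hcj ▸
      Q.mul_mem (Q.inv_mem (hMc.1.le hm)) (hQn.conj_mem x (hVQ hxV) b)⟩
    rw [← hmb', mul_assoc]
    exact mul_mem hm hd
  obtain ⟨m, hm, n, hbv⟩ := hex _ (hQn.conj_mem v (hVQ hvV) b)
  -- Additively this is b - n, with n the scalar of b on V/(V ∩ M). Its image lies in M and misses
  -- v, so it has a nontrivial kernel: an eigenspace.
  let φ : V → V := fun x ↦ ⟨b * x * b⁻¹ * (x : G) ^ (-n),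
    mul_mem (hVn.conj_mem x x.2 b) (zpow_mem x.2 _)⟩
  have hφM : ∀ x, (φ x : G) ∈ M := by
    intro x
    obtain ⟨m', hm', i, hx⟩ := hex x (hVQ x.2)
    have hm'V : m' ∈ V := by
      rw [eq_mul_inv_of_mul_eq hx.symm]
      exact mul_mem x.2 (inv_mem (zpow_mem hvV i))
    have hvi : (v ^ i) ∈ Q := zpow_mem (hVQ hvV) i
    have key : (φ x : G) = (b * m' * b⁻¹) * m ^ i * m' ^ (-n) := by
      change b * x * b⁻¹ * (x : G) ^ (-n) = _
      rw [hx, (hc m' (hMc.1.le hm') _ hvi).mul_zpow]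
      have h1 : b * (m' * v ^ i) * b⁻¹ = (b * m' * b⁻¹) * (m ^ i * (v ^ n) ^ i) := by
        rw [← (hc m (hMc.1.le hm) _ (zpow_mem (hVQ hvV) n)).mul_zpow, ← hbv, conj_zpow]
        group
      rw [h1, (hc _ (zpow_mem (hMc.1.le hm') _) _ (zpow_mem hvi _)).eq, ← zpow_mul, ← zpow_mul]
      have h2 : v ^ (n * i) * v ^ (i * -n) = 1 := by rw [← zpow_add]; simp [mul_comm]
      calc _ = b * m' * b⁻¹ * m ^ i * (v ^ (n * i) * v ^ (i * -n)) * m' ^ (-n) := by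
            simp only [mul_assoc]
        _ = _ := by rw [h2, mul_one]
    rw [key]
    exact mul_mem (mul_mem (hstab m' hm'V hm') (zpow_mem hm i)) (zpow_mem hm' _)
  have hninj : ¬ Function.Injective φ := fun h ↦ by
    obtain ⟨x, hx⟩ := Finite.surjective_of_injective h ⟨v, hvV⟩
    have hxM := hφM x
    rw [hx] at hxM
    exact hvM hxM
  simp only [Function.Injective, not_forall] at hninj
  obtain ⟨x, y, hxy, hne⟩ := hninj
  have hxy' : b * x * b⁻¹ * (x : G) ^ (-n) = b * y * b⁻¹ * (y : G) ^ (-n) :=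
    congrArg Subtype.val hxy
  refine hV.mem_powerNormalizer hG (x := (y : G)⁻¹ * x) (n := n) (mul_mem (inv_mem y.2) x.2)
    (fun h ↦ hne (Subtype.ext (inv_mul_eq_one.1 h).symm)) ?_
  have hyx := hc _ (hVQ (inv_mem y.2)) _ (hVQ x.2)
  rw [hyx.mul_zpow, inv_zpow]
  rw [zpow_neg, zpow_neg, mul_inv_eq_iff_eq_mul] at hxy'
  calc b * ((y : G)⁻¹ * x) * b⁻¹ = (b * y * b⁻¹)⁻¹ * (b * x * b⁻¹) := by group
    _ = _ := by rw [hxy']; group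

/-! ### The case of a unique minimal normal subgroup -/

/-- If `V` is a `q`-group contained in all nontrivial normal subgroups, then nilpotent normal
subgroups are `q`-groups. -/
theorem isPGroup_of_isNilpotent_of_forall_le [Finite G] {q : ℕ} [Fact q.Prime] {V N : Subgroup G}
    [hN : N.Normal] (hV1 : V ≠ ⊥) (hVq : IsPGroup q V)
    (hV : ∀ W : Subgroup G, W.Normal → W ≠ ⊥ → V ≤ W) (hNn : Group.IsNilpotent N) :
    IsPGroup q N := by
  let R : Sylow q N := default
  have hR : (R : Subgroup N) = ⊤ := by
    refine eq_top_of_forall_sylow_le fun r _ ↦ ?_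
    by_cases hrq : r = q
    · subst hrq
      exact ⟨R, le_rfl⟩
    let T : Sylow r N := default
    have hTn : (T : Subgroup N).Normal := inferInstance
    have := T.characteristic_of_normal hTn
    have hT : (T : Subgroup N).map N.subtype = ⊥ := by
      by_contra h
      have hle := hV _ inferInstance h
      exact hV1 (disjoint_self.1
        ((IsPGroup.disjoint_of_ne q r (Ne.symm hrq) _ _ hVq (T.2.map N.subtype)).mono_right hle))
    refine ⟨T, ?_⟩
    rw [(map_eq_bot_iff_of_injective _ N.subtype_injective).1 hT]
    exact bot_le
  have h := R.2
  rw [hR] at h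
  exact h.of_equiv topEquiv

theorem map_subtype_covBy_map_subtype {A : Subgroup G} {M S : Subgroup A} :
    M.map A.subtype ⋖ S.map A.subtype ↔ M ⋖ S := by
  refine Set.OrdConnected.apply_covBy_apply_iff
    (OrderEmbedding.ofMapLEIff (fun K : Subgroup A ↦ K.map A.subtype)
      fun _ _ ↦ map_le_map_iff_of_injective A.subtype_injective) ⟨?_⟩
  rintro _ ⟨K, rfl⟩ _ ⟨L, rfl⟩ X hX
  exact ⟨X.subgroupOf A, map_subgroupOf_eq_of_le (hX.2.trans (map_subtype_le L))⟩

theorem _root_.IsWeakNormalProduct.permutes_of_covBy {A B : Subgroup G}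
    (hAB : IsWeakNormalProduct A B) {q : ℕ} [Fact q.Prime] (S : Sylow q A) {M : Subgroup G}
    (hM : M ⋖ (S : Subgroup A).map A.subtype) : B.Permutes M := by
  have hMA : (M.subgroupOf A).map A.subtype = M :=
    map_subgroupOf_eq_of_le (hM.1.le.trans (map_subtype_le _))
  rw [← hMA] at hM ⊢
  exact hAB.permutes q S _ (map_subtype_covBy_map_subtype.1 hM)

/-- A' ≤ G' is a normal q-subgroup of A, so S contains A'. -/
theorem _root_.Sylow.normal_of_isPGroup_commutator [Finite G] {A : Subgroup G} {q : ℕ}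
    [Fact q.Prime] (hG : IsPGroup q (_root_.commutator G)) (S : Sylow q A) :
    (S : Subgroup A).Normal := by
  have hle : _root_.commutator A ≤ (_root_.commutator G).subgroupOf A := by
    rw [subgroupOf, ← map_le_iff_le_comap, _root_.commutator_def, map_commutator]
    exact commutator_mono le_top le_top
  have hA : IsPGroup q (_root_.commutator A) := hG.comap_subtype.to_le hle
  have hS := hA.le_sylow_of_normal S
  exact Normal.of_commutator_le A hS

/-- In a weak normal product `G = AB` of w-supersoluble subgroups with `G'` a `q`-group, let `V` be
a minimal normal `q`-subgroup inside `A` which is contained in all nontrivial normal subgroups.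
If `P` is a `p`-subgroup with `P ⊔ V` being `ℙ`-subnormal, then `P` acts on `V` by power maps. -/
theorem IsMinimalNormal.le_powerNormalizer_of_isWeakNormalProduct [Finite G] {A B V : Subgroup G}
    (hAB : IsWeakNormalProduct A B) (hA : IsWSupersoluble A) (hB : IsWSupersoluble B)
    (hG : Group.IsNilpotent (_root_.commutator G)) (hV : V.IsMinimalNormal) (hVA : V ≤ A)
    {p q : ℕ} [Fact p.Prime] [Fact q.Prime] (hpq : p ≠ q) (he : ∀ x ∈ V, x ^ q = 1)
    (hU : ∀ W : Subgroup G, W.Normal → W ≠ ⊥ → V ≤ W) {P : Subgroup G} (hP : IsPGroup p P)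
    (hPV : (P ⊔ V).IsPSubnormal) : P ≤ V.powerNormalizer := by
  have hVn := hV.normal
  have hAn := hAB.normal
  have hVq := isPGroup_of_forall_pow_eq_one he
  have hG' := isPGroup_of_isNilpotent_of_forall_le hV.ne_bot hVq hU hG
  let S : Sylow q A := default
  have hSn := S.normal_of_isPGroup_commutator hG'
  have hSc := S.characteristic_of_normal hSn
  set Q := (S : Subgroup A).map A.subtype with hQdef
  have hQn : Q.Normal := inferInstance
  have hQ : IsPGroup q Q := S.2.map _
  have hVQ : V ≤ Q := by
    rw [← map_subgroupOf_eq_of_le hVA]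
    exact map_mono (IsPGroup.le_sylow_of_normal (hVq.comap_subtype) S)
  by_cases hM : ∀ M, M ⋖ Q → V ≤ M
  · exact hV.le_powerNormalizer_of_forall_covBy hG hpq he hQn hVQ hP hQ hPV hM
  push Not at hM
  obtain ⟨M, hMc, hVM⟩ := hM
  have hcore : M.normalCore = ⊥ := by
    by_contra h
    exact hVM ((hU _ inferInstance h).trans M.normalCore_le)
  obtain ⟨hcomm, hpow⟩ := commute_and_pow_eq_one_of_covBy hQ hMc hcore
  have hA' : A ≤ V.powerNormalizer :=
    hV.le_powerNormalizer_of_isWSupersoluble hG hVq hA (by rw [inf_eq_left.2 hVA]; exact hV.ne_bot)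
  have hB' : B ≤ V.powerNormalizer := by
    by_cases hVB : V ⊓ B = ⊥
    · exact hV.le_powerNormalizer_of_permutes hG hQn hVQ hcomm hpow hVB
        fun M hM ↦ hAB.permutes_of_covBy S hM
    · exact hV.le_powerNormalizer_of_isWSupersoluble hG hVq hB hVB
  intro g _
  obtain ⟨a, ha, b, hb, rfl⟩ : g ∈ (A : Set G) * (B : Set G) := hAB.mul_eq ▸ Set.mem_univ g
  exact mul_mem (hA' ha) (hB' hb)

end Subgroup

/-! ### The induction -/

theorem corollaryB {G : Type*} [Group G] [Finite G] (A B : Subgroup G)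
    (hAB : IsWeakNormalProduct A B)
    (hA : IsWSupersoluble A) (hB : IsWSupersoluble B)
    (hG : Group.IsNilpotent (commutator G)) :
    IsWSupersoluble G := by
  induction hn : Nat.card G using Nat.strong_induction_on generalizing G with
  | _ n ih =>
  by_cases hA1 : A = ⊥
  · refine hB.of_surjective (f := B.subtype) fun g ↦ ?_
    obtain ⟨a, ha, b, hb, rfl⟩ : g ∈ (A : Set G) * (B : Set G) := hAB.mul_eq ▸ Set.mem_univ g
    rw [hA1] at ha
    exact ⟨⟨b, hb⟩, by simp [Subgroup.mem_bot.1 ha]⟩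
  obtain ⟨V, hVA, hV⟩ := Subgroup.exists_isMinimalNormal_le hAB.normal hA1
  have hVn := hV.normal
  have hquot : ∀ W : Subgroup G, [W.Normal] → W ≠ ⊥ → IsWSupersoluble (G ⧸ W) := by
    intro W _ hW
    have hf := QuotientGroup.mk'_surjective W
    refine ih (Nat.card (G ⧸ W)) ?_ _ _ (hAB.map hf)
      (hA.of_surjective ((QuotientGroup.mk' W).subgroupMap_surjective A))
      (hB.of_surjective ((QuotientGroup.mk' W).subgroupMap_surjective B))
      (commutator_isNilpotent_of_surjective hG hf) rfl
    rw [← hn, W.card_eq_card_quotient_mul_card_subgroup]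
    exact lt_mul_of_one_lt_right Nat.card_pos (W.one_lt_card_iff_ne_bot.2 hW)
  intro p _ P
  have hPV := (hquot V hV.ne_bot).sup_isPSubnormal P
  obtain ⟨q, hq, he⟩ := hV.exists_prime_pow_eq_one hG
  have := Fact.mk hq
  have hVq := Subgroup.isPGroup_of_forall_pow_eq_one he
  by_cases hpq : p = q
  · subst hpq
    rwa [sup_eq_left.2 (hVq.le_sylow_of_normal P)] at hPV
  suffices hP : (P : Subgroup G) ≤ V.powerNormalizer by
    rw [Subgroup.isPSubnormal_iff_reflTransGen] at hPV ⊢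
    exact (Subgroup.reflTransGen_primeStep_sup hP (IsPGroup.disjoint_of_ne p q hpq _ _ P.2 hVq)
      (fun x hx y hy ↦ hV.commute hG hx hy) he).trans hPV
  by_cases hU : ∀ W : Subgroup G, W.Normal → W ≠ ⊥ → V ≤ W
  · exact hV.le_powerNormalizer_of_isWeakNormalProduct hAB hA hB hG hVA hpq he hU P.2 hPV
  push Not at hU
  obtain ⟨W, hWn, hW1, hVW⟩ := hU
  have hVW' := (hV.le_or_inf_eq_bot hWn).resolve_left hVW
  -- PW/W is a p-group, so the q-group V ∩ PW falls into V ∩ W = 1.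
  have hd : V ⊓ ((P : Subgroup G) ⊔ W) = ⊥ :=
    le_bot_iff.1 (hVW' ▸ le_inf inf_le_left (Subgroup.inf_sup_le_of_isPGroup hpq P.2 hVq))
  obtain ⟨x, hxV, hx1, hx⟩ :=
    ((hquot W hW1).sup_isPSubnormal P).exists_zpowers_eq hV.ne_bot hd
  intro g hg
  obtain ⟨n, hgx⟩ := hx g (Subgroup.mem_sup_left hg)
  exact hV.mem_powerNormalizer hG hxV hx1 hgx
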